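/- Let $\mathcal H_d$ be the Hermitian operators on $\mathbb C^d$. For operators, $A\ll B$ means that the support of $A$ (the orthogonal complement of its kernel) is contained in that of $B$. For a Hermitian operator $A$, $A^{-1}$ is the generalized (Moore–Penrose) inverse, and for $A\ge 0$, $A^{-1/2}:=(A^{1/2})^{-1}$. For a density operator $\rho$, $D[\rho^{1/2}](H)$ denotes the Fréchet derivative at $\rho$, in the direction $H$, of the square root as a map on the Hermitian operators $H\ll\rho$ (all of $\mathcal H_d$ if $\rho>0$). Let $F(\rho,\sigma)=\|\rho^{1/2}\sigma^{1/2}\|_1^2$ be the fidelity and $\mathsf D_{\max}(\rho\|\sigma)=\inf\{\lambda\in\mathbb R:\rho\le e^{\lambda}\sigma\}$ the max-divergence. Let $\rho\ll\sigma$ be density operators on $\mathbb C^d$, let $\rho_n,\sigma_n$ ($n\in\mathbb N$) be random density operators on $\mathbb C^d$ such that, for every $n$, almost surely $\rho_n\ll\sigma_n\ll\sigma$ and $\rho_n\ll\rho$, and let $r_n>0$ with $r_n\to\infty$. Suppose that $\big(r_n(\rho_n-\rho),\,r_n(\sigma_n-\sigma)\big)$ converges weakly (in distribution) to $(L_1,L_2)$.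 Then the derivative $D[\rho^{1/2}]$ exists, and $$r_n\big(F(\rho_n,\sigma_n)-F(\rho,\sigma)\big)\xrightarrow{w} F(\rho,\sigma)^{1/2}\,\mathrm{Tr}\Big[\Big(D[\rho^{1/2}](L_1)\,\sigma\rho^{1/2}+\rho^{1/2}\sigma\, D[\rho^{1/2}](L_1)+\rho^{1/2}L_2\rho^{1/2}\Big)\big(\rho^{1/2}\sigma\rho^{1/2}\big)^{-1/2}\Big].$$ If, moreover, the largest eigenvalue of $\rho^{1/2}\sigma^{-1}\rho^{1/2}$ is simple and $\Pi_{\max}$ denotes its eigenprojection, then $$r_n\big(\mathsf D_{\max}(\rho_n\|\sigma_n)-\mathsf D_{\max}(\rho\|\sigma)\big)\xrightarrow{w} e^{-\mathsf D_{\max}(\rho\|\sigma)}\,\mathrm{Tr}\Big[\Big(D[\rho^{1/2}](L_1)\,\sigma^{-1}\rho^{1/2}+\rho^{1/2}\sigma^{-1} D[\rho^{1/2}](L_1)-\rho^{1/2}\sigma^{-1}L_2\sigma^{-1}\rho^{1/2}\Big)\Pi_{\max}\Big].$$ -/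

import Mathlib

open MeasureTheory Filter Topology Matrix
open scoped ComplexOrder

namespace QuantumLimit

/-- Operators on the `d`-dimensional Hilbert space `ℂ^d`. -/
abbrev Op (d : ℕ) := Matrix (Fin d) (Fin d) ℂ

/-- Operators carry their Borel σ-algebra (the topology is that of any norm). -/
noncomputable instance instMeasurableSpaceOp (d : ℕ) : MeasurableSpace (Op d) := borel (Op d)

instance instBorelSpaceOp (d : ℕ) : BorelSpace (Op d) := ⟨rfl⟩

instance instSecondCountableOp (d : ℕ) : SecondCountableTopology (Op d) :=
  inferInstanceAs (SecondCountableTopology (Fin d → Fin d → ℂ))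

/-- Density operators: positive semidefinite with unit trace. -/
def IsDensity {d : ℕ} (A : Op d) : Prop := A.PosSemidef ∧ A.trace = 1

/-- The support of an operator: the orthogonal complement of its kernel. -/
noncomputable def supp {d : ℕ} (A : Op d) : Submodule ℂ (EuclideanSpace ℂ (Fin d)) :=
  (LinearMap.ker (Matrix.toEuclideanLin A))ᗮ

/-- `A ≪ B`: the support of `A` is contained in that of `B`. -/
def Dominated {d : ℕ} (A B : Op d) : Prop := supp A ≤ supp B

theorem dominated_iff {d : ℕ} (A B : Op d) :
    Dominated A B ↔ ∀ v : Fin d → ℂ, B *ᵥ v = 0 → A *ᵥ v = 0 := by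
  unfold Dominated supp
  rw [Submodule.orthogonal_le_orthogonal_iff]
  constructor
  · intro h v hv
    have h1 : WithLp.toLp 2 v ∈ LinearMap.ker (Matrix.toEuclideanLin B) := by
      simp [LinearMap.mem_ker, Matrix.toLpLin_apply, hv]
    have h2 := h h1
    simpa [LinearMap.mem_ker, Matrix.toLpLin_apply] using h2
  · intro h v hv
    simp only [LinearMap.mem_ker, Matrix.toLpLin_apply, WithLp.toLp_eq_zero] at hv ⊢
    exact h _ hv

/-- The square root `A^{1/2}` of a positive semidefinite operator, by functional calculus. -/
noncomputable def psqrt {d : ℕ} (A : Op d) : Op d := cfc Real.sqrt A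

/-- The generalized (Moore–Penrose) inverse of a Hermitian operator, by functional calculus:
nonzero eigenvalues are inverted and the eigenvalue `0` is kept. -/
noncomputable def ginv {d : ℕ} (A : Op d) : Op d := cfc (fun x : ℝ => x⁻¹) A

/-- The Penrose equations for `ginv`. -/
theorem ginv_penrose {d : ℕ} {A : Op d} (hA : A.IsHermitian) :
    A * ginv A * A = A ∧ ginv A * A * ginv A = ginv A ∧
      (A * ginv A).IsHermitian ∧ (ginv A * A).IsHermitian := by
  have hsa : IsSelfAdjoint A := hA
  have hc : ∀ f : ℝ → ℝ, ContinuousOn f (spectrum ℝ A) := fun f =>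
    (Matrix.finite_real_spectrum (A := A)).continuousOn f
  have h1 : A * ginv A = cfc (fun x : ℝ => x * x⁻¹) A := by
    rw [cfc_mul (fun x : ℝ => x) (fun x => x⁻¹) A (hc _) (hc _), cfc_id' ℝ A]; rfl
  have h2 : ginv A * A = cfc (fun x : ℝ => x⁻¹ * x) A := by
    rw [cfc_mul (fun x : ℝ => x⁻¹) (fun x => x) A (hc _) (hc _), cfc_id' ℝ A]; rfl
  refine ⟨?_, ?_, ?_, ?_⟩
  · rw [h1]
    nth_rewrite 2 [← cfc_id' ℝ A]
    rw [← cfc_mul _ _ A (hc _) (hc _)]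
    simp only [mul_inv_mul_cancel]
    exact cfc_id' ℝ A
  · rw [h2]
    unfold ginv
    rw [← cfc_mul _ _ A (hc _) (hc _)]
    congr 1
    ext x
    by_cases hx : x = 0 <;> simp [hx]
  · rw [h1]; exact cfc_predicate (p := IsSelfAdjoint) _ A
  · rw [h2]; exact cfc_predicate (p := IsSelfAdjoint) _ A

/-- The Hermitian operators supported in the support of `A`, on which derivatives at `A` are
taken. For `A` of full rank these are all Hermitian operators. -/
def suppHermitian {d : ℕ} (A : Op d) : Set (Op d) := {B | B.IsHermitian ∧ Dominated B A}

/-- `D[A^{1/2}]`: the Fréchet derivative of the operator square root at `A`, along Hermitian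
operators supported in the support of `A`. -/
noncomputable def dsqrt {d : ℕ} (A : Op d) : Op d →L[ℝ] Op d :=
  fderivWithin ℝ psqrt (suppHermitian A) A

/-- The trace norm `‖A‖₁ = Tr |A|`, where `|A| = (A* A)^{1/2}`. -/
noncomputable def traceNorm {d : ℕ} (A : Op d) : ℝ := (psqrt (Aᴴ * A)).trace.re

/-- The fidelity `F(ρ,σ) = ‖ρ^{1/2} σ^{1/2}‖₁²`. -/
noncomputable def fidelity {d : ℕ} (ρ σ : Op d) : ℝ := traceNorm (psqrt ρ * psqrt σ) ^ 2

/-- The max-divergence `D_max(ρ‖σ) = inf {t : ρ ≤ e^t σ}`. For density operators with `ρ ≪ σ`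
the set is nonempty and bounded below; only such pairs matter here. -/
noncomputable def Dmax {d : ℕ} (ρ σ : Op d) : ℝ :=
  sInf {t : ℝ | (Real.exp t • σ - ρ).PosSemidef}

/-- The largest eigenvalue of a Hermitian operator. -/
noncomputable def maxEig {d : ℕ} (A : Op d) : ℝ := sSup (spectrum ℝ A)

/-- The eigenprojection of a Hermitian operator at its largest eigenvalue. -/
noncomputable def maxProj {d : ℕ} (A : Op d) : Op d :=
  cfc ((({maxEig A} : Set ℝ)).indicator (fun _ : ℝ => (1 : ℝ))) A

/-- The largest eigenvalue is simple: its eigenspace is one-dimensional. -/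
def SimpleMaxEig {d : ℕ} (A : Op d) : Prop :=
  Module.finrank ℂ (Module.End.eigenspace (Matrix.toLin' A) (maxEig A : ℂ)) = 1

/-- The limit variable for the fidelity as a function of the limits `(L₁, L₂)`. -/
noncomputable def fidelityLimit {d : ℕ} (ρ σ L₁ L₂ : Op d) : ℝ :=
  Real.sqrt (fidelity ρ σ) *
    ((dsqrt ρ L₁ * σ * psqrt ρ + psqrt ρ * σ * dsqrt ρ L₁ + psqrt ρ * L₂ * psqrt ρ) *
      ginv (psqrt (psqrt ρ * σ * psqrt ρ))).trace.re

/-- The limit variable for the max-divergence as a function of the limits `(L₁, L₂)`. -/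
noncomputable def DmaxLimit {d : ℕ} (ρ σ L₁ L₂ : Op d) : ℝ :=
  Real.exp (-Dmax ρ σ) *
    ((dsqrt ρ L₁ * ginv σ * psqrt ρ + psqrt ρ * ginv σ * dsqrt ρ L₁
        - psqrt ρ * ginv σ * L₂ * ginv σ * psqrt ρ) *
      maxProj (psqrt ρ * ginv σ * psqrt ρ)).trace.re

end QuantumLimit

/-! Fidelity and max-divergence are Fréchet differentiable at `(ρ, σ)` within the set `statePairs ρ
σ`, where the random pairs almost surely lie; the delta method then carries the weak limit through
the derivative.

Square root and generalized inverse are badly behaved at singular operators, but not along operators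
dominated by `A`. With `Q = kerProj A`, any Hermitian `B ≪ A` near `A` makes `B + Q` positive
definite, and `psqrt B = psqrt (B + Q) - Q`, `ginv B = (B + Q)⁻¹ - Q`. Differentiability thus
reduces to the invertible case: the inverse, and the square root as local inverse of `S ↦ S * S`,
whose derivative `H ↦ S H + H S` is invertible for `S > 0` (`hasFDerivWithinAt_psqrt`,
`hasFDerivWithinAt_ginv`).

The fidelity is the squared trace of the root of `X = ρ^{1/2} σ ρ^{1/2}`, and `2 Tr D[X^{1/2}](H) =
Tr (X^{-1/2} H)` up to a kernel term that vanishes here. The max-divergence is the logarithm of the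
largest eigenvalue of `ρ^{1/2} σ^{-1} ρ^{1/2}`, which, when simple, has derivative `Re Tr (Π H)`
(`hasFDerivWithinAt_maxEig`). -/

/-- The **delta method**: if `f` has derivative `f'` at `x` within `S`, the random variables `X n`
take values in `S` and `r n • (X n - x)` converges in distribution to `L`, with `r n → ∞`, then
`r n • (f (X n) - f x)` converges in distribution to `f' L`. -/
theorem MeasureTheory.TendstoInDistribution.deltaMethod {E Ω Ω' : Type*} [MeasurableSpace Ω]
    [MeasurableSpace Ω'] {P : Measure Ω} [IsProbabilityMeasure P] {P' : Measure Ω'}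
    [IsProbabilityMeasure P'] [NormedAddCommGroup E] [NormedSpace ℝ E] [MeasurableSpace E]
    [BorelSpace E] {f : E → ℝ} {f' : E →L[ℝ] ℝ} {S : Set E} {x : E}
    (hf : HasFDerivWithinAt f f' S x) {r : ℕ → ℝ} (hr_pos : ∀ n, 0 < r n)
    (hr : Tendsto r atTop atTop) {X : ℕ → Ω → E} (hX : ∀ n, ∀ᵐ ω ∂P, X n ω ∈ S)
    (hfX : ∀ n, AEMeasurable (fun ω => f (X n ω)) P) {L : Ω' → E}
    (hL : TendstoInDistribution (fun n ω => r n • (X n ω - x)) atTop L (fun _ => P) P') :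
    TendstoInDistribution (fun n ω => r n * (f (X n ω) - f x)) atTop (fun ω => f' (L ω))
      (fun _ => P) P' := by
  have hlin := hL.continuous_comp f'.continuous
  -- Slutsky: it remains to show that the linearization error, scaled by `r n`, tends to zero in
  -- probability.
  refine tendstoInDistribution_of_tendstoInMeasure_sub _ _ hlin ?_
    fun n => ((hfX n).sub_const _).const_mul _
  rw [tendstoInMeasure_iff_norm]
  intro ε hε
  rw [ENNReal.tendsto_nhds_zero]
  intro η hη
  have := Measure.isProbabilityMeasure_map (μ := P') hL.aemeasurable_limit
  obtain ⟨M, hM0, hM⟩ : ∃ M : ℝ, 0 < M ∧ (P'.map L) {z | M ≤ ‖z‖} < η := by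
    have h := tendsto_measure_iInter_atTop (μ := P'.map L)
      (s := fun n : ℕ => {z : E | (n : ℝ) ≤ ‖z‖})
      (fun n => (isClosed_le continuous_const continuous_norm).measurableSet.nullMeasurableSet)
      (fun m n hmn z (hz : (n : ℝ) ≤ ‖z‖) =>
        show (m : ℝ) ≤ ‖z‖ from (Nat.cast_le.2 hmn).trans hz) ⟨0, measure_ne_top _ _⟩
    have hempty : ⋂ n : ℕ, {z : E | (n : ℝ) ≤ ‖z‖} = ∅ := by
      ext z
      obtain ⟨n, hn⟩ := exists_nat_gt ‖z‖
      simpa using ⟨n, hn⟩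
    rw [hempty, measure_empty] at h
    obtain ⟨n, hn, hn0⟩ := ((h.eventually_lt_const hη).and (eventually_gt_atTop 0)).exists
    exact ⟨n, Nat.cast_pos.2 hn0, hn⟩
  have htight : ∀ᶠ n in atTop, P {ω | M ≤ ‖r n • (X n ω - x)‖} < η := by
    have hcl : IsClosed {z : E | M ≤ ‖z‖} := isClosed_le continuous_const continuous_norm
    have h := ProbabilityMeasure.limsup_measure_closed_le_of_tendsto hL.tendsto hcl
    filter_upwards [eventually_lt_of_limsup_lt (h.trans_lt hM)] with n hn
    rwa [ProbabilityMeasure.coe_mk,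
      Measure.map_apply_of_aemeasurable (hL.forall_aemeasurable n) hcl.measurableSet] at hn
  -- With slope `ε / (2 * M)`, the scaled error is at most `ε / 2` wherever the scaled deviation is
  -- below `M`; `r n > M / δ` then puts `X n` in the `δ`-ball.
  have hlo := (hasFDerivWithinAt_iff_isLittleO.1 hf).bound
    (show (0 : ℝ) < ε / (2 * M) by positivity)
  obtain ⟨δ, hδ, hball⟩ := Metric.mem_nhdsWithin_iff.1 hlo
  filter_upwards [htight, hr.eventually_gt_atTop (M / δ)] with n hn hrn
  refine le_trans (measure_mono_ae ?_) hn.le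
  filter_upwards [hX n] with ω hω (hε' : ε ≤ ‖_‖)
  show M ≤ ‖r n • (X n ω - x)‖
  by_contra! hlt
  have hnorm : ‖r n • (X n ω - x)‖ = r n * ‖X n ω - x‖ := by
    rw [norm_smul, Real.norm_of_nonneg (hr_pos n).le]
  rw [hnorm] at hlt
  have hclose : X n ω ∈ Metric.ball x δ := by
    rw [mem_ball_iff_norm]
    rw [div_lt_iff₀ hδ] at hrn
    exact lt_of_mul_lt_mul_left (hlt.trans hrn) (hr_pos n).le
  have hb : ‖f (X n ω) - f x - f' (X n ω - x)‖ ≤ ε / (2 * M) * ‖X n ω - x‖ :=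
    hball ⟨hclose, hω⟩
  have hrw : r n * (f (X n ω) - f x) - f' (r n • (X n ω - x)) - 0 =
      r n * (f (X n ω) - f x - f' (X n ω - x)) := by
    simp only [map_smul, smul_eq_mul]; ring
  have h1 : ε ≤ r n * ‖f (X n ω) - f x - f' (X n ω - x)‖ := by
    refine hε'.trans (le_of_eq ?_)
    simp only [Pi.sub_apply, Function.comp_apply, Pi.zero_apply]
    rw [hrw, norm_mul, Real.norm_of_nonneg (hr_pos n).le]
  have h2 : r n * ‖f (X n ω) - f x - f' (X n ω - x)‖ ≤ ε / (2 * M) * M :=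
    calc _ ≤ r n * (ε / (2 * M) * ‖X n ω - x‖) := by gcongr; exact (hr_pos n).le
      _ = ε / (2 * M) * (r n * ‖X n ω - x‖) := by ring
      _ ≤ _ := by gcongr
  have h3 : ε / (2 * M) * M = ε / 2 := by field_simp
  linarith

namespace QuantumLimit

section
open scoped MatrixOrder

variable {d : ℕ}

lemma continuousOn_spectrum (A : Op d) (f : ℝ → ℝ) : ContinuousOn f (spectrum ℝ A) :=
  (Matrix.finite_real_spectrum (A := A)).continuousOn f

/-! ### The square root -/

lemma posSemidef_psqrt (A : Op d) : (psqrt A).PosSemidef :=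
  Matrix.nonneg_iff_posSemidef.1 (cfc_nonneg fun x _ => Real.sqrt_nonneg x)

lemma isHermitian_psqrt (A : Op d) : (psqrt A).IsHermitian := (posSemidef_psqrt A).isHermitian

lemma psqrt_mul_self {A : Op d} (hA : A.PosSemidef) : psqrt A * psqrt A = A := by
  have hsa : IsSelfAdjoint A := hA.1
  have hc := continuousOn_spectrum A
  unfold psqrt
  rw [← cfc_mul _ _ A (hc _) (hc _)]
  nth_rewrite 2 [← cfc_id' ℝ A]
  refine cfc_congr fun x hx => Real.mul_self_sqrt ?_
  exact spectrum_nonneg_of_nonneg (Matrix.nonneg_iff_posSemidef.2 hA) hx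

lemma psqrt_eq_of_mul_self {A S : Op d} (hS : S.PosSemidef) (h : S * S = A) : psqrt A = S := by
  have hsa : IsSelfAdjoint S := hS.1
  have hc := continuousOn_spectrum S
  have hA : A = cfc (fun x : ℝ => x * x) S := by
    rw [cfc_mul _ _ S (hc _) (hc _), cfc_id' ℝ S, h]
  unfold psqrt
  rw [hA, ← cfc_comp' Real.sqrt (fun x => x * x) S Real.continuous_sqrt.continuousOn (hc _)]
  nth_rewrite 2 [← cfc_id' ℝ S]
  refine cfc_congr fun x hx => Real.sqrt_mul_self ?_
  exact spectrum_nonneg_of_nonneg (Matrix.nonneg_iff_posSemidef.2 hS) hx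

lemma posDef_psqrt {A : Op d} (hA : A.PosDef) : (psqrt A).PosDef := by
  rw [(posSemidef_psqrt A).posDef_iff_isUnit]
  have h := hA.isUnit
  rw [← psqrt_mul_self hA.posSemidef] at h
  exact isUnit_of_mul_isUnit_left h

lemma mul_eq_zero_of_conj_eq_zero {A B : Op d} (hA : A.PosSemidef) (h : Bᴴ * A * B = 0) :
    A * B = 0 := by
  have h1 : psqrt A * B = 0 := by
    rw [← Matrix.conjTranspose_mul_self_eq_zero, Matrix.conjTranspose_mul,
      (isHermitian_psqrt A).eq, Matrix.mul_assoc, ← Matrix.mul_assoc (psqrt A),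
      psqrt_mul_self hA, ← Matrix.mul_assoc, h]
  rw [← psqrt_mul_self hA, Matrix.mul_assoc, h1, Matrix.mul_zero]

lemma psqrt_mul_eq_zero_iff {A B : Op d} (hA : A.PosSemidef) : psqrt A * B = 0 ↔ A * B = 0 := by
  constructor <;> intro h
  · rw [← psqrt_mul_self hA, Matrix.mul_assoc, h, Matrix.mul_zero]
  · rw [← Matrix.conjTranspose_mul_self_eq_zero, Matrix.conjTranspose_mul,
      (isHermitian_psqrt A).eq, Matrix.mul_assoc, ← Matrix.mul_assoc (psqrt A),
      psqrt_mul_self hA, h, Matrix.mul_zero]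

lemma mul_eq_zero_comm_of_isHermitian {A B : Op d} (hA : A.IsHermitian) (hB : B.IsHermitian)
    (h : A * B = 0) : B * A = 0 := by
  rw [← hA.eq, ← hB.eq, ← Matrix.conjTranspose_mul, h, Matrix.conjTranspose_zero]

/-! ### The projection onto the kernel -/

/-- The orthogonal projection onto the kernel of a Hermitian operator. -/
noncomputable def kerProj (A : Op d) : Op d := 1 - A * ginv A

lemma isHermitian_ginv (A : Op d) : (ginv A).IsHermitian :=
  cfc_predicate (p := IsSelfAdjoint) _ A

lemma ginv_mul_comm {A : Op d} (hA : A.IsHermitian) : ginv A * A = A * ginv A := by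
  have h := (ginv_penrose hA).2.2.1.eq
  rwa [Matrix.conjTranspose_mul, hA.eq, (isHermitian_ginv A).eq] at h

lemma isHermitian_kerProj {A : Op d} (hA : A.IsHermitian) : (kerProj A).IsHermitian :=
  Matrix.isHermitian_one.sub (ginv_penrose hA).2.2.1

lemma mul_kerProj {A : Op d} (hA : A.IsHermitian) : A * kerProj A = 0 := by
  rw [kerProj, Matrix.mul_sub, Matrix.mul_one, ← ginv_mul_comm hA, ← Matrix.mul_assoc,
    (ginv_penrose hA).1, sub_self]

lemma kerProj_mul {A : Op d} (hA : A.IsHermitian) : kerProj A * A = 0 :=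
  mul_eq_zero_comm_of_isHermitian hA (isHermitian_kerProj hA) (mul_kerProj hA)

lemma kerProj_mul_self {A : Op d} (hA : A.IsHermitian) : kerProj A * kerProj A = kerProj A := by
  nth_rewrite 1 [kerProj]
  rw [← ginv_mul_comm hA, Matrix.sub_mul, Matrix.mul_assoc, mul_kerProj hA]
  simp

lemma posSemidef_kerProj {A : Op d} (hA : A.IsHermitian) : (kerProj A).PosSemidef := by
  have h := Matrix.posSemidef_conjTranspose_mul_self (kerProj A)
  rwa [(isHermitian_kerProj hA).eq, kerProj_mul_self hA] at h

lemma posDef_add_kerProj {A : Op d} (hA : A.PosSemidef) : (A + kerProj A).PosDef := by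
  rw [(hA.add (posSemidef_kerProj hA.1)).posDef_iff_isUnit]
  refine IsUnit.of_mul_eq_one (ginv A + kerProj A) ?_
  have h1 : kerProj A * ginv A = 0 := by
    rw [kerProj, Matrix.sub_mul, ← ginv_mul_comm hA.1, (ginv_penrose hA.1).2.1]; simp
  rw [Matrix.add_mul, Matrix.mul_add, Matrix.mul_add, mul_kerProj hA.1, h1, kerProj_mul_self hA.1,
    kerProj]
  abel

lemma Dominated.mul_eq_zero {A B C : Op d} (h : Dominated A B) (hC : B * C = 0) : A * C = 0 := by
  rw [dominated_iff] at h
  ext i j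
  have h1 : B *ᵥ C.col j = 0 := by
    ext k
    exact congrFun (congrFun hC k) j
  exact congrFun (h _ h1) i

lemma dominated_of_mul_kerProj {A B : Op d} (hB : B.IsHermitian) (h : A * kerProj B = 0) :
    Dominated A B := by
  rw [dominated_iff]
  intro v hv
  have h1 : kerProj B *ᵥ v = v := by
    rw [kerProj, ← ginv_mul_comm hB, Matrix.sub_mulVec, ← Matrix.mulVec_mulVec, hv]; simp
  rw [← h1, Matrix.mulVec_mulVec, h, Matrix.zero_mulVec]

lemma Dominated.mul_kerProj {A B : Op d} (hB : B.IsHermitian) (h : Dominated A B) :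
    A * kerProj B = 0 := h.mul_eq_zero (QuantumLimit.mul_kerProj hB)

/-- Adding a projection orthogonal to a positive semidefinite operator commutes with the square
root. -/
lemma psqrt_add_of_mul_eq_zero {B Q : Op d} (hB : B.PosSemidef) (hQ : Q.PosSemidef)
    (hQQ : Q * Q = Q) (hBQ : B * Q = 0) : psqrt (B + Q) = psqrt B + Q := by
  have h1 := (psqrt_mul_eq_zero_iff hB).2 hBQ
  have h2 := mul_eq_zero_comm_of_isHermitian (isHermitian_psqrt B) hQ.1 h1
  refine psqrt_eq_of_mul_self ((posSemidef_psqrt B).add hQ) ?_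
  rw [Matrix.add_mul, Matrix.mul_add, Matrix.mul_add, h1, h2, hQQ, psqrt_mul_self hB]
  abel

/-- The generalized inverse of `B` in terms of an honest inverse, when `Q` is the projection onto
the kernel of `B`. -/
lemma ginv_add_of_mul_eq_zero {B Q : Op d} (hB : B.IsHermitian) (hQ : Q.IsHermitian)
    (hQQ : Q * Q = Q) (hBQ : B * Q = 0) (hu : IsUnit (B + Q)) : ginv B + Q = (B + Q)⁻¹ := by
  have hQB := mul_eq_zero_comm_of_isHermitian hB hQ hBQ
  have hcomm := ginv_mul_comm hB
  have hgQ : ginv B * Q = 0 := by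
    have h : ginv B = ginv B * (ginv B * B) := by
      rw [hcomm, ← Matrix.mul_assoc, (ginv_penrose hB).2.1]
    rw [h, Matrix.mul_assoc, Matrix.mul_assoc, hBQ, Matrix.mul_zero, Matrix.mul_zero]
  have hQg := mul_eq_zero_comm_of_isHermitian (isHermitian_ginv B) hQ hgQ
  -- Multiplying either side by `B + Q` gives `B`; invertibility is what makes `Q` the whole kernel
  -- projection.
  have hker : B * ginv B = 1 - Q := by
    refine hu.mul_left_cancel ?_
    rw [Matrix.add_mul, ← Matrix.mul_assoc Q, hQB, Matrix.zero_mul, ← hcomm, ← Matrix.mul_assoc,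
      (ginv_penrose hB).1, Matrix.mul_sub, Matrix.add_mul B Q Q, hBQ, hQQ]
    simp
  symm
  refine Matrix.inv_eq_right_inv ?_
  rw [Matrix.add_mul, Matrix.mul_add, Matrix.mul_add, hBQ, hQg, hQQ, hker]
  abel

lemma ginv_add_kerProj {A : Op d} (hA : A.PosSemidef) :
    ginv A + kerProj A = (A + kerProj A)⁻¹ :=
  ginv_add_of_mul_eq_zero hA.1 (isHermitian_kerProj hA.1) (kerProj_mul_self hA.1)
    (mul_kerProj hA.1) (posDef_add_kerProj hA).isUnit

/-! ### Trace and charpoly -/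

/-- `Aᴴ * A` and `A * Aᴴ` have the same characteristic polynomial. This makes the fidelity depend on
`σ` itself and not on its root. -/
lemma trace_psqrt_conjTranspose_mul_self (A : Op d) :
    (psqrt (Aᴴ * A)).trace = (psqrt (A * Aᴴ)).trace := by
  have h1 : (Aᴴ * A).IsHermitian := Matrix.isHermitian_conjTranspose_mul_self A
  have h2 : (A * Aᴴ).IsHermitian := Matrix.isHermitian_mul_conjTranspose_self A
  rw [Matrix.trace_eq_sum_roots_charpoly, Matrix.trace_eq_sum_roots_charpoly, psqrt, psqrt,
    h1.charpoly_cfc_eq, h2.charpoly_cfc_eq,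
    (h1.eigenvalues_eq_eigenvalues_iff h2).2 (Matrix.charpoly_mul_comm _ _)]

lemma fidelity_eq {ρ σ : Op d} (hσ : σ.PosSemidef) :
    fidelity ρ σ = (psqrt (psqrt ρ * σ * psqrt ρ)).trace.re ^ 2 := by
  rw [fidelity, traceNorm, trace_psqrt_conjTranspose_mul_self, Matrix.conjTranspose_mul,
    (isHermitian_psqrt σ).eq, (isHermitian_psqrt ρ).eq, Matrix.mul_assoc,
    ← Matrix.mul_assoc (psqrt σ), psqrt_mul_self hσ, Matrix.mul_assoc]

lemma sqrt_fidelity {ρ σ : Op d} (hσ : σ.PosSemidef) :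
    Real.sqrt (fidelity ρ σ) = (psqrt (psqrt ρ * σ * psqrt ρ)).trace.re := by
  rw [fidelity_eq hσ, Real.sqrt_sq]
  exact (Complex.le_def.1 (posSemidef_psqrt _).trace_nonneg).1

lemma posSemidef_psqrt_mul_mul {ρ σ : Op d} (hσ : σ.PosSemidef) :
    (psqrt ρ * σ * psqrt ρ).PosSemidef := by
  have h := hσ.conjTranspose_mul_mul_same (psqrt ρ)
  rwa [(isHermitian_psqrt ρ).eq] at h

end

/-! ### Differentiability of the square root and the generalized inverse. -/

section
open scoped Matrix.Norms.L2Operator MatrixOrder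

variable {d : ℕ}

lemma spectrum_subset_closedBall (A : Op d) :
    spectrum ℝ A ⊆ Metric.closedBall (0 : ℝ) (‖A‖ * ‖(1 : Op d)‖) :=
  spectrum.subset_closedBall_norm_mul A

/-- Near `A` all spectra lie in one compact ball, over which the functional calculus is continuous.
`Real.sqrt` is continuous on the whole line, so positivity plays no role. -/
lemma continuousOn_psqrt : ContinuousOn (psqrt (d := d)) {A | A.IsHermitian} := by
  refine continuousOn_of_locally_continuousOn fun A hA => ?_
  set R : ℝ := (‖A‖ + 1) * ‖(1 : Op d)‖
  refine ⟨Metric.ball A 1, Metric.isOpen_ball, Metric.mem_ball_self one_pos, ?_⟩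
  have h := continuousOn_cfc (𝕜 := ℝ) (Op d) (p := IsSelfAdjoint)
    (isCompact_closedBall (0 : ℝ) R) Real.sqrt Real.continuous_sqrt.continuousOn
  refine h.mono fun B hB => ⟨hB.1, (spectrum_subset_closedBall B).trans ?_⟩
  refine Metric.closedBall_subset_closedBall ?_
  have h1 : ‖B‖ ≤ ‖A‖ + 1 := by
    have h2 := mem_ball_iff_norm.1 hB.2
    have h3 := norm_add_le A (B - A)
    rw [add_sub_cancel] at h3
    linarith
  exact mul_le_mul_of_nonneg_right h1 (norm_nonneg _)

/-- Positive definite operators form an open set among the Hermitian ones. -/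
lemma eventually_posDef {A : Op d} (hA : A.PosDef) :
    ∀ᶠ B in 𝓝[{B : Op d | B.IsHermitian}] A, B.PosDef := by
  have h : ∀ᶠ B in 𝓝 A, spectrum ℝ B ⊆ Set.Ioi 0 := by
    have h1 := upperHemicontinuous_spectrum ℝ (Op d) A (Set.Ioi 0)
      (isOpen_Ioi.mem_nhdsSet.2 fun x hx => ?_)
    · exact h1.mono fun B hB => subset_of_mem_nhdsSet hB
    · rw [hA.1.spectrum_real_eq_range_eigenvalues] at hx
      obtain ⟨i, rfl⟩ := hx
      exact hA.eigenvalues_pos i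
  filter_upwards [h.filter_mono nhdsWithin_le_nhds, self_mem_nhdsWithin] with B hB hBh
  rw [Matrix.IsHermitian.posDef_iff_eigenvalues_pos hBh]
  exact fun i => hB (Matrix.IsHermitian.eigenvalues_mem_spectrum_real hBh i)

/-- The Sylvester operator `H ↦ S H + H S`. -/
noncomputable def sylvester (S : Op d) : Op d →ₗ[ℝ] Op d :=
  LinearMap.mulLeft ℝ S + LinearMap.mulRight ℝ S

/-- Multiplying `S H + H S = 0` by `Hᴴ` and taking the trace gives two nonnegative terms with sum
zero, hence `S H = 0`. -/
lemma sylvester_injective {S : Op d} (hS : S.PosDef) : Function.Injective (sylvester S) := by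
  rw [injective_iff_map_eq_zero]
  intro H hH
  have hH : S * H + H * S = 0 := hH
  have h1 : (Hᴴ * S * H).trace + (H * S * Hᴴ).trace = 0 := by
    rw [Matrix.trace_mul_comm (H * S), ← Matrix.trace_add, Matrix.mul_assoc, ← Matrix.mul_add, hH]
    simp
  have h2 := hS.posSemidef.conjTranspose_mul_mul_same H
  have h3 := hS.posSemidef.mul_mul_conjTranspose_same H
  have h4 := ((add_eq_zero_iff_of_nonneg h2.trace_nonneg h3.trace_nonneg).1 h1).1
  have h5 := mul_eq_zero_of_conj_eq_zero hS.posSemidef (h2.trace_eq_zero_iff.1 h4)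
  exact hS.isUnit.mul_left_cancel (h5.trans (Matrix.mul_zero S).symm)

/-- The Sylvester operator of a positive definite `S` as an equivalence. -/
noncomputable def sylvesterEquiv {S : Op d} (hS : S.PosDef) : Op d ≃L[ℝ] Op d :=
  (LinearEquiv.ofInjectiveEndo (sylvester S) (sylvester_injective hS)).toContinuousLinearEquiv

/-- Squaring undoes `psqrt` near `A` among Hermitian operators, so continuity of `psqrt` and
invertibility of the derivative of squaring suffice. -/
lemma hasFDerivWithinAt_psqrt_of_posDef {A : Op d} (hA : A.PosDef) :
    HasFDerivWithinAt psqrt ((sylvesterEquiv (posDef_psqrt hA)).symm : Op d →L[ℝ] Op d)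
      {B | B.IsHermitian} A := by
  have hsq : HasFDerivAt (fun S : Op d => S * S)
      (sylvesterEquiv (posDef_psqrt hA) : Op d →L[ℝ] Op d) (psqrt A) := by
    refine ((hasFDerivAt_id (𝕜 := ℝ) (psqrt A)).mul' (hasFDerivAt_id (psqrt A))).congr_fderiv ?_
    ext1 H
    rfl
  refine HasFDerivWithinAt.of_local_left_inverse (t := Set.univ) ?_ hsq.hasFDerivWithinAt hA.1 ?_
  · rw [nhdsWithin_univ]
    exact continuousOn_psqrt A hA.1
  · filter_upwards [eventually_posDef hA] with B hB using psqrt_mul_self hB.posSemidef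

/-- Near `A ≥ 0`, the Hermitian operators supported in the support of `A` become positive
definite after adding the projection onto the kernel of `A`. -/
lemma eventually_posDef_add_kerProj {A : Op d} (hA : A.PosSemidef) :
    ∀ᶠ B in 𝓝[suppHermitian A] A, (B + kerProj A).PosDef := by
  have ht : Tendsto (fun B : Op d => B + kerProj A) (𝓝[suppHermitian A] A)
      (𝓝[{B : Op d | B.IsHermitian}] (A + kerProj A)) :=
    (continuous_add_const _).continuousWithinAt.tendsto_nhdsWithin
      fun B hB => hB.1.add (isHermitian_kerProj hA.1)
  exact ht.eventually (eventually_posDef (posDef_add_kerProj hA))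

/-- Compression by `1 - kerProj A` removes the projection and fixes `B`. -/
lemma posSemidef_of_posDef_add_kerProj {A B : Op d} (hA : A.PosSemidef)
    (hB : B ∈ suppHermitian A) (h : (B + kerProj A).PosDef) : B.PosSemidef := by
  have h0 := hB.2.mul_kerProj hA.1
  have h0' := mul_eq_zero_comm_of_isHermitian hB.1 (isHermitian_kerProj hA.1) h0
  have h1 := h.posSemidef.conjTranspose_mul_mul_same (1 - kerProj A)
  have h2 : (1 - kerProj A)ᴴ * (B + kerProj A) * (1 - kerProj A) = B := by
    rw [(Matrix.isHermitian_one.sub (isHermitian_kerProj hA.1)).eq]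
    simp only [Matrix.mul_add, Matrix.mul_sub, Matrix.sub_mul, Matrix.add_mul, Matrix.one_mul,
      Matrix.mul_one, h0, h0', kerProj_mul_self hA.1]
    simp
  rwa [h2] at h1

/-- A derivative of the square root at `A ≥ 0` along the Hermitian operators supported in the
support of `A`. -/
noncomputable def psqrtDeriv {A : Op d} (hA : A.PosSemidef) : Op d →L[ℝ] Op d :=
  (sylvesterEquiv (posDef_psqrt (posDef_add_kerProj hA))).symm

lemma mem_suppHermitian_self {A : Op d} (hA : A.IsHermitian) : A ∈ suppHermitian A :=
  ⟨hA, le_refl _⟩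

lemma hasFDerivWithinAt_psqrt {A : Op d} (hA : A.PosSemidef) :
    HasFDerivWithinAt psqrt (psqrtDeriv hA) (suppHermitian A) A := by
  have h1 : HasFDerivWithinAt (fun B : Op d => B + kerProj A) (.id ℝ (Op d)) (suppHermitian A) A :=
    (hasFDerivWithinAt_id _ _).add_const _
  have h2 := (hasFDerivWithinAt_psqrt_of_posDef (posDef_add_kerProj hA)).comp A h1
    fun B hB => hB.1.add (isHermitian_kerProj hA.1)
  have h3 := h2.sub_const (kerProj A)
  have key : ∀ B : Op d, B.PosSemidef → B ∈ suppHermitian A →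
      psqrt B = psqrt (B + kerProj A) - kerProj A := fun B hB hB' => by
    rw [psqrt_add_of_mul_eq_zero hB (posSemidef_kerProj hA.1) (kerProj_mul_self hA.1)
      (hB'.2.mul_kerProj hA.1), add_sub_cancel_right]
  refine h3.congr_of_eventuallyEq ?_ (key A hA (mem_suppHermitian_self hA.1))
  filter_upwards [eventually_posDef_add_kerProj hA, self_mem_nhdsWithin] with B hB hB'
  exact key B (posSemidef_of_posDef_add_kerProj hA hB' hB) hB'

/-- `fderivWithin` selects some derivative, perhaps different from `psqrtDeriv` off the supported
Hermitian directions; only its being a derivative is used later. -/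
lemma hasFDerivWithinAt_dsqrt {A : Op d} (hA : A.PosSemidef) :
    HasFDerivWithinAt psqrt (dsqrt A) (suppHermitian A) A :=
  (hasFDerivWithinAt_psqrt hA).differentiableWithinAt.hasFDerivWithinAt

/-- `K = psqrtDeriv hA H` solves `S K + K S = H`; multiply by `S⁻¹` and use cyclicity of the trace.
-/
lemma two_mul_trace_psqrtDeriv {A : Op d} (hA : A.PosSemidef) (H : Op d) :
    2 * (psqrtDeriv hA H).trace = ((ginv (psqrt A) + kerProj A) * H).trace := by
  set S := psqrt (A + kerProj A)
  have hSd : S.PosDef := posDef_psqrt (posDef_add_kerProj hA)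
  have hSA : S = psqrt A + kerProj A :=
    psqrt_add_of_mul_eq_zero hA (posSemidef_kerProj hA.1) (kerProj_mul_self hA.1)
      (mul_kerProj hA.1)
  have hinv : ginv (psqrt A) + kerProj A = S⁻¹ := by
    rw [hSA]
    exact ginv_add_of_mul_eq_zero (isHermitian_psqrt A) (isHermitian_kerProj hA.1)
      (kerProj_mul_self hA.1) ((psqrt_mul_eq_zero_iff hA).2 (mul_kerProj hA.1))
      (hSA ▸ hSd.isUnit)
  have hu : IsUnit S.det := (Matrix.isUnit_iff_isUnit_det _).1 hSd.isUnit
  have hK : S * psqrtDeriv hA H + psqrtDeriv hA H * S = H :=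
    (sylvesterEquiv hSd).apply_symm_apply H
  rw [hinv]
  nth_rewrite 2 [← hK]
  rw [Matrix.mul_add, Matrix.trace_add, ← Matrix.mul_assoc, Matrix.nonsing_inv_mul _ hu,
    Matrix.one_mul, Matrix.trace_mul_comm, Matrix.mul_assoc, Matrix.mul_nonsing_inv _ hu,
    Matrix.mul_one, two_mul]

/-- The derivative of the generalized inverse along Hermitian operators supported in the support
of `A`. -/
lemma hasFDerivWithinAt_ginv {A : Op d} (hA : A.PosSemidef) :
    HasFDerivWithinAt ginv
      (-ContinuousLinearMap.mulLeftRight ℝ (Op d) (ginv A + kerProj A) (ginv A + kerProj A))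
      (suppHermitian A) A := by
  have h1 : HasFDerivWithinAt (fun B : Op d => B + kerProj A) (.id ℝ (Op d)) (suppHermitian A) A :=
    (hasFDerivWithinAt_id _ _).add_const _
  obtain ⟨u, hu⟩ := (posDef_add_kerProj hA).isUnit
  have hinv : (↑u⁻¹ : Op d) = ginv A + kerProj A := by
    rw [ginv_add_kerProj hA, ← hu, Matrix.coe_units_inv]
  have h2 := hasFDerivAt_ringInverse (𝕜 := ℝ) u
  rw [hu, hinv] at h2
  have h3 := (h2.comp_hasFDerivWithinAt A h1).sub_const (kerProj A)
  rw [ContinuousLinearMap.comp_id] at h3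
  have key : ∀ B : Op d, (B + kerProj A).PosDef → B ∈ suppHermitian A →
      ginv B = Ring.inverse (B + kerProj A) - kerProj A := fun B hB hB' => by
    rw [← Matrix.nonsing_inv_eq_ringInverse,
      ← ginv_add_of_mul_eq_zero hB'.1 (isHermitian_kerProj hA.1) (kerProj_mul_self hA.1)
      (hB'.2.mul_kerProj hA.1) hB.isUnit, add_sub_cancel_right]
  refine h3.congr_of_eventuallyEq ?_
    (key A (posDef_add_kerProj hA) (mem_suppHermitian_self hA.1))
  filter_upwards [eventually_posDef_add_kerProj hA, self_mem_nhdsWithin] with B hB hB'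
  exact key B hB hB'

end

/-! ### First-order perturbation of a simple largest eigenvalue. -/

section
open scoped Matrix.Norms.L2Operator MatrixOrder

variable {d : ℕ}

/-- The real linear functional `H ↦ Re Tr(A H)`. -/
noncomputable def reTraceMul (A : Op d) : Op d →L[ℝ] ℝ :=
  LinearMap.toContinuousLinearMap
    (Complex.reLm.comp ((Matrix.traceLinearMap (Fin d) ℝ ℂ).comp (LinearMap.mulLeft ℝ A)))

@[simp] lemma reTraceMul_apply (A H : Op d) : reTraceMul A H = (A * H).trace.re := rfl

lemma isGreatest_maxEig [Nonempty (Fin d)] {Y : Op d} (hY : Y.IsHermitian) :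
    IsGreatest (spectrum ℝ Y) (maxEig Y) := by
  have hne : (spectrum ℝ Y).Nonempty := by
    rw [hY.spectrum_real_eq_range_eigenvalues]
    exact Set.range_nonempty _
  exact ⟨hne.csSup_mem Matrix.finite_real_spectrum,
    fun x hx => le_csSup Matrix.finite_real_spectrum.bddAbove hx⟩

lemma smul_one_sub_eq_cfc {Y : Op d} (hY : Y.IsHermitian) (t : ℝ) :
    t • (1 : Op d) - Y = cfc (fun x : ℝ => t - x) Y := by
  have hsa : IsSelfAdjoint Y := hY
  have hc := continuousOn_spectrum Y
  rw [cfc_sub _ _ Y (hc _) (hc _), cfc_const t Y, cfc_id' ℝ Y, Algebra.algebraMap_eq_smul_one]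

lemma maxEig_le_iff [Nonempty (Fin d)] {Y : Op d} (hY : Y.IsHermitian) {t : ℝ} :
    maxEig Y ≤ t ↔ (t • (1 : Op d) - Y).PosSemidef := by
  have hsa : IsSelfAdjoint Y := hY
  rw [smul_one_sub_eq_cfc hY, ← Matrix.nonneg_iff_posSemidef,
    cfc_nonneg_iff _ _ (continuousOn_spectrum Y _), isLUB_le_iff (isGreatest_maxEig hY).isLUB]
  simp [upperBounds]

lemma isHermitian_maxProj (Y : Op d) : (maxProj Y).IsHermitian :=
  cfc_predicate (p := IsSelfAdjoint) _ Y

lemma maxProj_mul_self (Y : Op d) : maxProj Y * maxProj Y = maxProj Y := by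
  have hc := continuousOn_spectrum Y
  unfold maxProj
  rw [← cfc_mul _ _ Y (hc _) (hc _)]
  congr 1
  ext x
  by_cases hx : x = maxEig Y <;> simp [hx]

lemma mul_maxProj {Y : Op d} (hY : Y.IsHermitian) : Y * maxProj Y = maxEig Y • maxProj Y := by
  have hsa : IsSelfAdjoint Y := hY
  have hc := continuousOn_spectrum Y
  have h1 : Y * maxProj Y =
      cfc (fun x : ℝ => x * (({maxEig Y} : Set ℝ)).indicator (fun _ : ℝ => (1 : ℝ)) x) Y := by
    rw [cfc_mul _ _ Y (hc _) (hc _), cfc_id' ℝ Y]; rfl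
  rw [h1, maxProj, ← cfc_smul _ _ Y (hc _)]
  refine cfc_congr fun x _ => ?_
  by_cases hx : x = maxEig Y <;> simp [hx]

/-- The spectral gap below the largest eigenvalue. -/
lemma exists_gap [Nonempty (Fin d)] {Y : Op d} (hY : Y.IsHermitian) :
    ∃ g : ℝ, 0 < g ∧ (maxEig Y • (1 : Op d) - Y - g • (1 - maxProj Y)).PosSemidef := by
  have hsa : IsSelfAdjoint Y := hY
  have hc := continuousOn_spectrum Y
  -- The rest of the finite spectrum is closed and misses the maximum; the gap is the radius of a
  -- ball avoiding it.
  have hfin : (spectrum ℝ Y \ {maxEig Y}).Finite :=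
    Matrix.finite_real_spectrum.subset Set.sdiff_subset
  obtain ⟨g, hg, hball⟩ := Metric.isOpen_iff.1 hfin.isClosed.isOpen_compl (maxEig Y) (by simp)
  refine ⟨g, hg, ?_⟩
  have h1 : g • (1 - maxProj Y) =
      cfc (fun x : ℝ => g * (1 - (({maxEig Y} : Set ℝ)).indicator (fun _ : ℝ => (1 : ℝ)) x)) Y := by
    rw [cfc_const_mul _ _ Y (hc _), cfc_sub _ _ Y (hc _) (hc _), cfc_const_one ℝ Y]; rfl
  rw [smul_one_sub_eq_cfc hY, h1, ← cfc_sub _ _ Y (hc _) (hc _), ← Matrix.nonneg_iff_posSemidef]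
  refine cfc_nonneg fun x hx => ?_
  by_cases hxm : x = maxEig Y
  · simp [hxm]
  · have h2 : x ∉ Metric.ball (maxEig Y) g := fun h => hball h ⟨hx, hxm⟩
    have h3 := (isGreatest_maxEig hY).2 hx
    rw [Metric.mem_ball, Real.dist_eq, abs_of_nonpos (by linarith)] at h2
    simp [hxm]
    linarith

/-- If the largest eigenvalue is simple, its eigenprojection has rank one. -/
lemma SimpleMaxEig.maxProj_mul_mul [Nonempty (Fin d)] {Y : Op d} (hY : Y.IsHermitian)
    (hs : SimpleMaxEig Y) :
    (maxProj Y).trace = 1 ∧ ∀ H : Op d, maxProj Y * H * maxProj Y =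
      (maxProj Y * H).trace • maxProj Y := by
  obtain ⟨i₀, hi₀⟩ : maxEig Y ∈ Set.range hY.eigenvalues :=
    hY.spectrum_real_eq_range_eigenvalues ▸ (isGreatest_maxEig hY).1
  have hmem : ∀ i, hY.eigenvalues i = maxEig Y → (⇑(hY.eigenvectorBasis i) : Fin d → ℂ) ∈
      Module.End.eigenspace (Matrix.toLin' Y) (maxEig Y : ℂ) := fun i hi => by
    rw [Module.End.mem_eigenspace_iff, Matrix.toLin'_apply, hY.mulVec_eigenvectorBasis, hi]
    rfl
  -- A second eigenvector for the same eigenvalue would be both proportional and orthogonal to the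
  -- first.
  have huniq : ∀ i, hY.eigenvalues i = maxEig Y → i = i₀ := fun i hi => by
    by_contra hne
    have hv0 : (⟨_, hmem i₀ hi₀⟩ : Module.End.eigenspace (Matrix.toLin' Y) (maxEig Y : ℂ)) ≠ 0 := by
      intro h
      have h1 : (⇑(hY.eigenvectorBasis i₀) : Fin d → ℂ) = 0 := congrArg Subtype.val h
      exact hY.eigenvectorBasis.orthonormal.ne_zero i₀ (by ext k; exact congrFun h1 k)
    obtain ⟨c, hc⟩ := (finrank_eq_one_iff_of_nonzero' _ hv0).1 hs ⟨_, hmem i hi⟩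
    have hc' : c • (⇑(hY.eigenvectorBasis i₀) : Fin d → ℂ) = ⇑(hY.eigenvectorBasis i) :=
      congrArg Subtype.val hc
    have hc2 : c • hY.eigenvectorBasis i₀ = hY.eigenvectorBasis i := by
      ext k; exact congrFun hc' k
    have h0 : inner ℂ (hY.eigenvectorBasis i) (hY.eigenvectorBasis i) = (0 : ℂ) := by
      nth_rewrite 2 [← hc2]
      rw [inner_smul_right, hY.eigenvectorBasis.orthonormal.2 hne, mul_zero]
    exact hY.eigenvectorBasis.orthonormal.ne_zero i (inner_self_eq_zero.1 h0)
  set U : Op d := (hY.eigenvectorUnitary : Op d)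
  have hUU : star U * U = 1 := Unitary.coe_star_mul_self _
  have hP : maxProj Y = U * Matrix.single i₀ i₀ 1 * star U := by
    rw [maxProj, hY.cfc_eq, Matrix.IsHermitian.cfc, Unitary.conjStarAlgAut_apply]
    congr 2
    rw [← Matrix.diagonal_single]
    congr 1
    ext i
    by_cases hi : i = i₀
    · subst hi; simp [hi₀]
    · have : hY.eigenvalues i ≠ maxEig Y := fun h => hi (huniq i h)
      simp [hi, this]
  have htr : ∀ H : Op d, (maxProj Y * H).trace = (star U * H * U) i₀ i₀ := fun H => by
    rw [hP, Matrix.mul_assoc, Matrix.mul_assoc, Matrix.trace_mul_comm, Matrix.mul_assoc,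
      Matrix.trace_single_mul, one_smul]
  constructor
  · have := htr 1
    rwa [Matrix.mul_one, Matrix.mul_one, hUU, Matrix.one_apply_eq] at this
  · intro H
    rw [htr, hP]
    have h1 : U * Matrix.single i₀ i₀ 1 * star U * H * (U * Matrix.single i₀ i₀ 1 * star U) =
        U * (Matrix.single i₀ i₀ 1 * (star U * H * U) * Matrix.single i₀ i₀ 1) * star U := by
      simp only [Matrix.mul_assoc]
    rw [h1, Matrix.single_mul_mul_single, one_mul, mul_one, ← Matrix.smul_mul, ← Matrix.mul_smul,
      Matrix.smul_single, smul_eq_mul, mul_one]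

lemma trace_mul_eq_re {A H : Op d} (hA : A.IsHermitian) (hH : H.IsHermitian) :
    (A * H).trace = ((A * H).trace.re : ℂ) := by
  have h : star (A * H).trace = (A * H).trace := by
    rw [← Matrix.trace_conjTranspose, Matrix.conjTranspose_mul, hA.eq, hH.eq, Matrix.trace_mul_comm]
  exact (Complex.conj_eq_iff_re.1 h).symm

/-- A quadratic upper bound for the perturbation of a simple largest eigenvalue. -/
lemma posSemidef_perturbation {Y H Q : Op d} {l g h η : ℝ} (hg : 0 < g)
    (hQ : Q.IsHermitian) (hQQ : Q * Q = Q) (hH : H.IsHermitian)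
    (hgap : (l • (1 : Op d) - Y - g • (1 - Q)).PosSemidef) (hQH : Q * H * Q = h • Q)
    (h1 : (η • (1 : Op d) - H).PosSemidef) (h2 : (η ^ 2 • (1 : Op d) - H * H).PosSemidef)
    (hhη : -η ≤ h) (hηg : 4 * η ≤ g) :
    ((l + h + 2 / g * η ^ 2) • (1 : Op d) - (Y + H)).PosSemidef := by
  have hQ' : (1 - Q).IsHermitian := Matrix.isHermitian_one.sub hQ
  have hQ'Q' : (1 - Q) * (1 - Q) = 1 - Q := by
    simp [Matrix.mul_sub, Matrix.sub_mul, hQQ]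
  have hpos : (1 - Q).PosSemidef := by
    have := Matrix.posSemidef_conjTranspose_mul_self (1 - Q)
    rwa [hQ'.eq, hQ'Q'] at this
  -- Completing the square: `e1`, scaled by `2 / g`, absorbs the off-diagonal blocks of `H` using
  -- half of the gap, and `e2` bounds the leftover `Q H² Q`. The other half of the gap covers the
  -- block of `H` on `1 - Q`, as `g / 2 + h - η ≥ g / 2 - 2 η ≥ 0`.
  have e1 := Matrix.posSemidef_conjTranspose_mul_self ((g / 2) • (1 - Q) - H * Q)
  have e2 := h2.conjTranspose_mul_mul_same Q
  have e3 := h1.conjTranspose_mul_mul_same (1 - Q)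
  have c1 : 0 ≤ 2 / g := by positivity
  have c2 : 0 ≤ 2 / g * η ^ 2 := by positivity
  have c3 : 0 ≤ g / 2 + h - η := by linarith
  have key := ((((hgap.add (e1.smul c1)).add (e2.smul c1)).add (hpos.smul c2)).add e3).add
    (hpos.smul c3)
  convert key using 1
  rw [Matrix.conjTranspose_sub, Matrix.conjTranspose_smul, Matrix.conjTranspose_mul, hQ'.eq, hQ.eq,
    hH.eq]
  have a2 : Q * (H * Q) = h • Q := by rw [← Matrix.mul_assoc, hQH]
  simp only [star_trivial, mul_sub, sub_mul, mul_one, one_mul, smul_mul_assoc, mul_smul_comm,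
    mul_assoc, hQQ, a2, smul_sub, smul_smul]
  match_scalars <;> field_simp <;> ring

lemma posSemidef_norm_smul_one_sub {H : Op d} (hH : H.IsHermitian) :
    (‖H‖ • (1 : Op d) - H).PosSemidef := by
  have h := IsSelfAdjoint.le_algebraMap_norm_self (a := H) hH
  rwa [Algebra.algebraMap_eq_smul_one, Matrix.le_iff] at h

lemma posSemidef_norm_sq_smul_one_sub {H : Op d} (hH : H.IsHermitian) :
    (‖H‖ ^ 2 • (1 : Op d) - H * H).PosSemidef := by
  have h := CStarAlgebra.star_mul_le_algebraMap_norm_sq (a := H)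
  rwa [Algebra.algebraMap_eq_smul_one, Matrix.le_iff, Matrix.star_eq_conjTranspose, hH.eq] at h

/-- The largest eigenvalue is differentiable along Hermitian operators where it is simple. -/
lemma hasFDerivWithinAt_maxEig [Nonempty (Fin d)] {Y : Op d} (hY : Y.IsHermitian)
    (hs : SimpleMaxEig Y) :
    HasFDerivWithinAt maxEig (reTraceMul (maxProj Y)) {B | B.IsHermitian} Y := by
  obtain ⟨g, hg, hgap⟩ := exists_gap hY
  obtain ⟨htr, hrank⟩ := hs.maxProj_mul_mul hY
  have hQ := isHermitian_maxProj Y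
  have hQQ := maxProj_mul_self Y
  set Q := maxProj Y
  -- compressing a positive semidefinite operator to the top eigenvector
  have hcomp : ∀ (A : Op d), A.PosSemidef → 0 ≤ (Q * A).trace.re := fun A hA => by
    have h1 := (hA.conjTranspose_mul_mul_same Q).trace_nonneg
    rw [hQ.eq, Matrix.trace_mul_comm, ← Matrix.mul_assoc, hQQ] at h1
    exact (Complex.le_def.1 h1).1
  have hlin : ∀ (t : ℝ) (A : Op d), (Q * (t • (1 : Op d) - A)).trace.re =
      t - (Q * A).trace.re := fun t A => by
    rw [Matrix.mul_sub, Matrix.mul_smul, Matrix.mul_one, Matrix.trace_sub, Matrix.trace_smul, htr]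
    simp
  have hQY : (Q * Y).trace.re = maxEig Y := by
    rw [Matrix.trace_mul_comm, mul_maxProj hY, Matrix.trace_smul, htr]
    simp
  rw [hasFDerivWithinAt_iff_isLittleO]
  have hsq : (fun B : Op d => ‖B - Y‖ ^ 2) =o[𝓝[{B | B.IsHermitian}] Y] fun B => B - Y := by
    have h := ((Asymptotics.isLittleO_norm_pow_id (E' := Op d) one_lt_two).comp_tendsto
      (tendsto_sub_nhds_zero_iff.2 (tendsto_id (α := Op d) (x := 𝓝 Y)))).mono
        (nhdsWithin_le_nhds (s := {B : Op d | B.IsHermitian}))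
    exact h
  refine Asymptotics.IsBigO.trans_isLittleO (Asymptotics.IsBigO.of_bound (2 / g) ?_) hsq
  have hnear : ∀ᶠ B in 𝓝[{B : Op d | B.IsHermitian}] Y, ‖B - Y‖ < g / 4 := by
    refine Filter.Eventually.filter_mono nhdsWithin_le_nhds ?_
    filter_upwards [Metric.ball_mem_nhds Y (show (0 : ℝ) < g / 4 by positivity)] with B hB
    exact mem_ball_iff_norm.1 hB
  filter_upwards [hnear, self_mem_nhdsWithin] with B hB hBh
  have hBh : B.IsHermitian := hBh
  have hH : (B - Y).IsHermitian := hBh.sub hY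
  rw [reTraceMul_apply, norm_pow, norm_norm, Real.norm_eq_abs]
  set H := B - Y with hHdef
  have hBY : B = Y + H := by rw [hHdef]; abel
  have hup : maxEig B ≤ maxEig Y + (Q * H).trace.re + 2 / g * ‖H‖ ^ 2 := by
    rw [maxEig_le_iff hBh, hBY]
    refine posSemidef_perturbation hg hQ hQQ hH hgap ?_ (posSemidef_norm_smul_one_sub hH)
      (posSemidef_norm_sq_smul_one_sub hH) ?_ (by linarith)
    · rw [hrank, trace_mul_eq_re hQ hH, Complex.ofReal_re]; rfl
    · have h1 := hcomp _ (posSemidef_norm_smul_one_sub hH.neg)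
      rw [hlin, norm_neg, Matrix.mul_neg, Matrix.trace_neg, Complex.neg_re] at h1
      linarith
  -- Variational bound: the top eigenvector of `Y` is a trial vector for `B`.
  have hlow : maxEig Y + (Q * H).trace.re ≤ maxEig B := by
    have h1 := hcomp _ ((maxEig_le_iff hBh).1 le_rfl)
    rw [hlin] at h1
    nth_rewrite 2 [hBY] at h1
    rw [Matrix.mul_add, Matrix.trace_add, Complex.add_re, hQY] at h1
    linarith
  rw [abs_le]
  have : 0 ≤ 2 / g * ‖H‖ ^ 2 := by positivity
  constructor <;> linarith

end

section
open scoped Matrix.Norms.L2Operator MatrixOrder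

variable {d : ℕ}

lemma isClosed_posSemidef : IsClosed {A : Op d | A.PosSemidef} := by
  have h := CStarAlgebra.isClosed_nonneg (A := Op d)
  simpa only [Matrix.nonneg_iff_posSemidef] using h

/-! ### The max-divergence as the logarithm of an eigenvalue -/

/-- The two sides are, up to a positive factor, the two Schur complements of the block matrix with
diagonal `M`, `t • 1` and off-diagonal `R`. -/
lemma posSemidef_smul_sub_iff {M R : Op d} (hM : M.PosDef) (hR : R.IsHermitian) {t : ℝ}
    (ht : 0 < t) :
    (t • M - R * R).PosSemidef ↔ (t • (1 : Op d) - R * M⁻¹ * R).PosSemidef := by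
  have hD : (t • (1 : Op d)).PosDef := Matrix.PosDef.one.smul ht
  have := hM.isUnit.invertible
  have := hD.isUnit.invertible
  have h1 := hM.fromBlocks₁₁ R (t • (1 : Op d))
  have h2 := Matrix.PosDef.fromBlocks₂₂ M R hD
  rw [hR.eq] at h1 h2
  rw [← h1, h2]
  have hinv : (t • (1 : Op d))⁻¹ = t⁻¹ • 1 := by
    refine Matrix.inv_eq_right_inv ?_
    rw [Matrix.smul_mul, Matrix.one_mul, smul_smul, mul_inv_cancel₀ ht.ne', one_smul]
  have h3 : t • M - R * R = t • (M - R * (t • (1 : Op d))⁻¹ * R) := by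
    rw [hinv, smul_sub]
    simp [smul_smul, ht.ne']
  constructor
  · intro h
    have := h.smul (inv_nonneg.2 ht.le)
    rwa [h3, smul_smul, inv_mul_cancel₀ ht.ne', one_smul] at this
  · intro h
    rw [h3]
    exact h.smul ht.le

lemma psqrt_mul_kerProj_of_dominated {ρ σ : Op d} (hρ : ρ.PosSemidef) (hσ : σ.PosSemidef)
    (hρσ : Dominated ρ σ) : psqrt ρ * kerProj σ = 0 :=
  (psqrt_mul_eq_zero_iff hρ).2 (hρσ.mul_kerProj hσ.1)

/-- `ρ ≤ t σ` in terms of the operator `ρ^{1/2} σ^{-1} ρ^{1/2}`. -/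
lemma posSemidef_smul_sub_iff_of_dominated {ρ σ : Op d} (hρ : ρ.PosSemidef) (hσ : σ.PosSemidef)
    (hρσ : Dominated ρ σ) {t : ℝ} (ht : 0 < t) :
    (t • σ - ρ).PosSemidef ↔ (t • (1 : Op d) - psqrt ρ * ginv σ * psqrt ρ).PosSemidef := by
  have hQ := isHermitian_kerProj hσ.1
  have h1 := psqrt_mul_kerProj_of_dominated hρ hσ hρσ
  have h3 := hρσ.mul_kerProj hσ.1
  have h4 := mul_eq_zero_comm_of_isHermitian hρ.1 hQ h3
  have h5 : psqrt ρ * (σ + kerProj σ)⁻¹ * psqrt ρ = psqrt ρ * ginv σ * psqrt ρ := by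
    rw [← ginv_add_kerProj hσ, Matrix.mul_add, h1, add_zero]
  rw [← h5, ← posSemidef_smul_sub_iff (posDef_add_kerProj hσ) (isHermitian_psqrt ρ) ht,
    psqrt_mul_self hρ]
  -- Adding `t • kerProj σ` replaces `σ` by `σ + kerProj σ`; compressing by `1 - kerProj σ` goes
  -- back.
  constructor
  · intro h
    convert h.add ((posSemidef_kerProj hσ.1).smul ht.le) using 1
    module
  · intro h
    convert h.conjTranspose_mul_mul_same (1 - kerProj σ) using 1
    rw [(Matrix.isHermitian_one.sub hQ).eq]
    simp only [Matrix.mul_add, Matrix.mul_sub, Matrix.sub_mul, Matrix.add_mul, Matrix.one_mul,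
      Matrix.mul_one, h3, h4, kerProj_mul_self hσ.1, mul_kerProj hσ.1, kerProj_mul hσ.1,
      Matrix.mul_smul, Matrix.smul_mul, smul_add]
    simp

lemma isHermitian_psqrt_mul_ginv_mul (ρ σ : Op d) :
    (psqrt ρ * ginv σ * psqrt ρ).IsHermitian := by
  have h := Matrix.isHermitian_conjTranspose_mul_mul (psqrt ρ) (isHermitian_ginv σ)
  rwa [(isHermitian_psqrt ρ).eq] at h

lemma IsDensity.nonempty {ρ : Op d} (hρ : IsDensity ρ) : Nonempty (Fin d) := by
  by_contra h
  rw [not_nonempty_iff] at h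
  have := hρ.2
  simp [Matrix.trace] at this

/-- Otherwise `ρ ≤ σ / 2`, which contradicts the unit traces. -/
lemma maxEig_pos_of_dominated {ρ σ : Op d} (hρ : IsDensity ρ) (hσ : IsDensity σ)
    (hρσ : Dominated ρ σ) : 0 < maxEig (psqrt ρ * ginv σ * psqrt ρ) := by
  have := hρ.nonempty
  by_contra! h
  have h1 := (maxEig_le_iff (isHermitian_psqrt_mul_ginv_mul ρ σ)).1
    (h.trans (show (0 : ℝ) ≤ 1 / 2 by norm_num))
  rw [← posSemidef_smul_sub_iff_of_dominated hρ.1 hσ.1 hρσ (by norm_num)] at h1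
  have h2 := (Complex.le_def.1 h1.trace_nonneg).1
  rw [Matrix.trace_sub, Matrix.trace_smul, hρ.2, hσ.2] at h2
  norm_num at h2

lemma posSemidef_exp_smul_sub_iff {ρ σ : Op d} (hρ : IsDensity ρ) (hσ : IsDensity σ)
    (hρσ : Dominated ρ σ) (t : ℝ) : (Real.exp t • σ - ρ).PosSemidef ↔
      Real.log (maxEig (psqrt ρ * ginv σ * psqrt ρ)) ≤ t := by
  have := hρ.nonempty
  rw [posSemidef_smul_sub_iff_of_dominated hρ.1 hσ.1 hρσ (Real.exp_pos t),
    ← maxEig_le_iff (isHermitian_psqrt_mul_ginv_mul ρ σ),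
    Real.log_le_iff_le_exp (maxEig_pos_of_dominated hρ hσ hρσ)]

lemma Dmax_eq_log {ρ σ : Op d} (hρ : IsDensity ρ) (hσ : IsDensity σ) (hρσ : Dominated ρ σ) :
    Dmax ρ σ = Real.log (maxEig (psqrt ρ * ginv σ * psqrt ρ)) := by
  have h : {t : ℝ | (Real.exp t • σ - ρ).PosSemidef} =
      Set.Ici (Real.log (maxEig (psqrt ρ * ginv σ * psqrt ρ))) :=
    Set.ext fun t => posSemidef_exp_smul_sub_iff hρ hσ hρσ t
  rw [Dmax, h, csInf_Ici]

lemma Dmax_le_iff {ρ σ : Op d} (hρ : IsDensity ρ) (hσ : IsDensity σ) (hρσ : Dominated ρ σ)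
    {t : ℝ} : Dmax ρ σ ≤ t ↔ (Real.exp t • σ - ρ).PosSemidef := by
  rw [posSemidef_exp_smul_sub_iff hρ hσ hρσ, Dmax_eq_log hρ hσ hρσ]

/-! ### Measurability -/

section Measurability

variable {Ω : Type*} [MeasurableSpace Ω] {P : Measure Ω} {X : Ω → Op d × Op d}

lemma aemeasurable_fidelity (hX : AEMeasurable X P)
    (hpos : ∀ ω, (X ω).1.PosSemidef ∧ (X ω).2.PosSemidef) :
    AEMeasurable (fun ω => fidelity (X ω).1 (X ω).2) P := by
  classical
  set S : Set (Op d × Op d) := {A | A.PosSemidef} ×ˢ {A | A.PosSemidef}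
  have hScl : IsClosed S := isClosed_posSemidef.prod isClosed_posSemidef
  have h1 : ContinuousOn (fun p : Op d × Op d => psqrt p.1) S :=
    continuousOn_psqrt.comp continuousOn_fst fun p hp => hp.1.1
  have h2 : ContinuousOn (fun p : Op d × Op d => psqrt (psqrt p.1 * p.2 * psqrt p.1)) S :=
    continuousOn_psqrt.comp ((h1.mul continuousOn_snd).mul h1) fun p hp =>
      (posSemidef_psqrt_mul_mul hp.2).1
  have h3 : ContinuousOn (fun p : Op d × Op d => fidelity p.1 p.2) S := by
    refine ContinuousOn.congr (((reTraceMul (1 : Op d)).continuous.comp_continuousOn h2).pow 2)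
      fun p hp => ?_
    simp [fidelity_eq (ρ := p.1) hp.2]
  have h4 := h3.measurable_piecewise (continuousOn_const (c := (0 : ℝ))) hScl.measurableSet
  refine (h4.comp_aemeasurable hX).congr (ae_of_all _ fun ω => ?_)
  exact Set.piecewise_eq_of_mem _ _ _ (hpos ω)

/-- Sublevel sets agree almost everywhere with preimages of closed sets. Domination holds only
almost surely, hence the detour through null measurability. -/
lemma aemeasurable_Dmax (hX : AEMeasurable X P)
    (hd : ∀ ω, IsDensity (X ω).1 ∧ IsDensity (X ω).2)
    (hdom : ∀ᵐ ω ∂P, Dominated (X ω).1 (X ω).2) :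
    AEMeasurable (fun ω => Dmax (X ω).1 (X ω).2) P := by
  suffices h : NullMeasurable (fun ω => Dmax (X ω).1 (X ω).2) P from h.aemeasurable
  refine @measurable_of_Iic ℝ (NullMeasurableSpace Ω P) _ _ _ _ _ _ _ _ fun t => ?_
  have hcl : IsClosed {p : Op d × Op d | (Real.exp t • p.2 - p.1).PosSemidef} :=
    isClosed_posSemidef.preimage (by fun_prop)
  have h1 : NullMeasurableSet {ω | (Real.exp t • (X ω).2 - (X ω).1).PosSemidef} P :=
    hX.nullMeasurableSet_preimage hcl.measurableSet
  refine h1.congr ?_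
  filter_upwards [hdom] with ω hω
  exact propext (Dmax_le_iff (hd ω).1 (hd ω).2 hω).symm

end Measurability

/-! ### Derivatives -/

/-- The pairs of states over which limits at `(ρ, σ)` are taken. -/
def statePairs (ρ σ : Op d) : Set (Op d × Op d) :=
  {p | IsDensity p.1 ∧ IsDensity p.2 ∧ Dominated p.1 p.2 ∧ Dominated p.2 σ ∧ Dominated p.1 ρ}

lemma exists_hasFDerivWithinAt_mul_mul {E : Type*} [NormedAddCommGroup E] [NormedSpace ℝ E]
    {a b : E → Op d} {a' b' : E →L[ℝ] Op d} {S : Set E} {x : E}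
    (ha : HasFDerivWithinAt a a' S x) (hb : HasFDerivWithinAt b b' S x) :
    ∃ c' : E →L[ℝ] Op d, (∀ H, c' H = a' H * b x * a x + a x * b x * a' H + a x * b' H * a x) ∧
      HasFDerivWithinAt (fun p => a p * b p * a p) c' S x := by
  refine ⟨_, fun H => ?_, (ha.mul' hb).mul' ha⟩
  simp only [_root_.add_apply, _root_.smul_apply, smul_eq_mul,
    MulOpposite.smul_eq_mul_unop, MulOpposite.unop_op, Pi.mul_apply]
  noncomm_ring

lemma hasFDerivWithinAt_psqrt_fst {ρ : Op d} (hρ : ρ.PosSemidef) (σ : Op d) :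
    HasFDerivWithinAt (fun p : Op d × Op d => psqrt p.1)
      ((dsqrt ρ).comp (.fst ℝ (Op d) (Op d))) (statePairs ρ σ) (ρ, σ) :=
  (hasFDerivWithinAt_dsqrt hρ).comp (ρ, σ) (f := Prod.fst) hasFDerivWithinAt_fst
    fun _ hp => ⟨hp.1.1.1, hp.2.2.2.2⟩

/-- If `ρ^{1/2} σ ρ^{1/2} v = 0` then `σ ρ^{1/2} v = 0`, so `ρ ρ^{1/2} v = 0` by `ρ ≪ σ`, and `v` is
in the kernel of `ρ`. -/
lemma psqrt_mul_kerProj_psqrt_mul_mul {ρ σ : Op d} (hρ : ρ.PosSemidef) (hσ : σ.PosSemidef)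
    (hρσ : Dominated ρ σ) : psqrt ρ * kerProj (psqrt ρ * σ * psqrt ρ) = 0 := by
  have hX := posSemidef_psqrt_mul_mul (ρ := ρ) hσ
  set Q := kerProj (psqrt ρ * σ * psqrt ρ)
  have h1 : σ * (psqrt ρ * Q) = 0 := by
    refine mul_eq_zero_of_conj_eq_zero hσ ?_
    have h : (psqrt ρ * Q)ᴴ * σ * (psqrt ρ * Q) = Qᴴ * (psqrt ρ * σ * psqrt ρ * Q) := by
      rw [Matrix.conjTranspose_mul, (isHermitian_psqrt ρ).eq]
      simp only [Matrix.mul_assoc]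
    rw [h, mul_kerProj hX.1, Matrix.mul_zero]
  have h2 : psqrt ρ * (psqrt ρ * Q) = 0 :=
    (psqrt_mul_eq_zero_iff hρ).2 (hρσ.mul_eq_zero h1)
  rw [← Matrix.mul_assoc, psqrt_mul_self hρ] at h2
  exact (psqrt_mul_eq_zero_iff hρ).2 h2

lemma exists_hasFDerivWithinAt_fidelity {ρ σ : Op d} (hρ : IsDensity ρ) (hσ : IsDensity σ)
    (hρσ : Dominated ρ σ) :
    ∃ F' : Op d × Op d →L[ℝ] ℝ, (∀ H, F' H = fidelityLimit ρ σ H.1 H.2) ∧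
      HasFDerivWithinAt (fun p : Op d × Op d => fidelity p.1 p.2) F' (statePairs ρ σ) (ρ, σ) := by
  have hX := posSemidef_psqrt_mul_mul (ρ := ρ) hσ.1
  obtain ⟨X', hX', hXd⟩ := exists_hasFDerivWithinAt_mul_mul
    (hasFDerivWithinAt_psqrt_fst hρ.1 σ)
    (hasFDerivWithinAt_snd (𝕜 := ℝ) (s := statePairs ρ σ) (p := (ρ, σ)))
  have h0 := psqrt_mul_kerProj_psqrt_mul_mul hρ.1 hσ.1 hρσ
  have h0' := mul_eq_zero_comm_of_isHermitian (isHermitian_psqrt ρ) (isHermitian_kerProj hX.1) h0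
  -- The kernel of `ρ^{1/2} σ ρ^{1/2}` lies in that of `ρ`, hence in that of `p.1`; the outer root
  -- is thus differentiated along admissible directions.
  have hmaps : Set.MapsTo (fun p : Op d × Op d => psqrt p.1 * p.2 * psqrt p.1) (statePairs ρ σ)
      (suppHermitian (psqrt ρ * σ * psqrt ρ)) := fun p hp => by
    refine ⟨(posSemidef_psqrt_mul_mul hp.2.1.1).1, dominated_of_mul_kerProj hX.1 ?_⟩
    rw [Matrix.mul_assoc, (psqrt_mul_eq_zero_iff hp.1.1).2 (hp.2.2.2.2.mul_eq_zero
      ((psqrt_mul_eq_zero_iff hρ.1).1 h0)), Matrix.mul_zero]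
  have h1 := (hasFDerivWithinAt_psqrt hX).comp (ρ, σ) hXd hmaps
  have h2 := ((reTraceMul (1 : Op d)).hasFDerivAt.comp_hasFDerivWithinAt (ρ, σ) h1).pow 2
  have heq : ∀ p ∈ statePairs ρ σ, fidelity p.1 p.2 = (reTraceMul (1 : Op d)
      (psqrt (psqrt p.1 * p.2 * psqrt p.1))) ^ 2 := fun p hp => by
    simp [fidelity_eq (ρ := p.1) hp.2.1.1]
  have hmem : (ρ, σ) ∈ statePairs ρ σ := ⟨hρ, hσ, hρσ, le_refl _, le_refl _⟩
  refine ⟨_, fun H => ?_, h2.congr heq (heq _ hmem)⟩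
  have htr : 2 * (psqrtDeriv hX (X' H)).trace.re =
      (X' H * ginv (psqrt (psqrt ρ * σ * psqrt ρ))).trace.re := by
    have h3 := congrArg Complex.re (two_mul_trace_psqrtDeriv hX (X' H))
    -- Every summand of `X' H` has a factor `psqrt ρ` at one end, which meets the kernel projection
    -- after a cyclic shift. No support property of `dsqrt ρ H.1` is needed.
    have h4 : (kerProj (psqrt ρ * σ * psqrt ρ) * X' H).trace = 0 := by
      rw [hX', Matrix.mul_add, Matrix.mul_add, Matrix.trace_add, Matrix.trace_add]
      simp only [← Matrix.mul_assoc, h0', Matrix.zero_mul, Matrix.trace_zero, add_zero]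
      rw [Matrix.trace_mul_comm]
      simp only [← Matrix.mul_assoc, h0, Matrix.zero_mul, Matrix.trace_zero]
    rw [Matrix.add_mul, Matrix.trace_add, h4, add_zero, Matrix.trace_mul_comm] at h3
    rw [← h3]
    simp
  rw [fidelityLimit, sqrt_fidelity hσ.1]
  have hX'' : X' H = dsqrt ρ H.1 * σ * psqrt ρ + psqrt ρ * σ * dsqrt ρ H.1 +
      psqrt ρ * H.2 * psqrt ρ := hX' H
  rw [← hX'', ← htr]
  simp
  ring

lemma exists_hasFDerivWithinAt_Dmax {ρ σ : Op d} (hρ : IsDensity ρ) (hσ : IsDensity σ)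
    (hρσ : Dominated ρ σ) (hs : SimpleMaxEig (psqrt ρ * ginv σ * psqrt ρ)) :
    ∃ F' : Op d × Op d →L[ℝ] ℝ, (∀ H, F' H = DmaxLimit ρ σ H.1 H.2) ∧
      HasFDerivWithinAt (fun p : Op d × Op d => Dmax p.1 p.2) F' (statePairs ρ σ) (ρ, σ) := by
  have := hρ.nonempty
  have hg : HasFDerivWithinAt (fun p : Op d × Op d => ginv p.2) _ (statePairs ρ σ) (ρ, σ) :=
    (hasFDerivWithinAt_ginv hσ.1).comp (ρ, σ) (f := Prod.snd) hasFDerivWithinAt_snd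
      fun p hp => ⟨hp.2.1.1.1, hp.2.2.2.1⟩
  obtain ⟨Y', hY', hYd⟩ := exists_hasFDerivWithinAt_mul_mul
    (hasFDerivWithinAt_psqrt_fst hρ.1 σ) hg
  have hY := isHermitian_psqrt_mul_ginv_mul ρ σ
  have hpos := maxEig_pos_of_dominated hρ hσ hρσ
  have h0 := (hasFDerivWithinAt_maxEig hY hs).comp (ρ, σ) hYd
    fun p _ => isHermitian_psqrt_mul_ginv_mul p.1 p.2
  have h1 := h0.log hpos.ne'
  have heq : ∀ p ∈ statePairs ρ σ, Dmax p.1 p.2 =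
      Real.log (maxEig (psqrt p.1 * ginv p.2 * psqrt p.1)) := fun p hp =>
    Dmax_eq_log hp.1 hp.2.1 hp.2.2.1
  have hmem : (ρ, σ) ∈ statePairs ρ σ := ⟨hρ, hσ, hρσ, le_refl _, le_refl _⟩
  refine ⟨_, fun H => ?_, h1.congr heq (heq _ hmem)⟩
  have hk := psqrt_mul_kerProj_of_dominated hρ.1 hσ.1 hρσ
  have hk' := mul_eq_zero_comm_of_isHermitian (isHermitian_psqrt ρ) (isHermitian_kerProj hσ.1.1) hk
  have hY'' : Y' H = dsqrt ρ H.1 * ginv σ * psqrt ρ + psqrt ρ * ginv σ * dsqrt ρ H.1 -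
      psqrt ρ * ginv σ * H.2 * ginv σ * psqrt ρ := by
    rw [hY', sub_eq_add_neg]
    congr 1
    show psqrt ρ * (-((ginv σ + kerProj σ) * H.2 * (ginv σ + kerProj σ))) * psqrt ρ = _
    rw [Matrix.mul_neg, Matrix.neg_mul]
    congr 1
    -- The `kerProj σ` terms in the derivative of `ginv` die against `psqrt ρ` because `ρ ≪ σ`.
    have e1 : psqrt ρ * (ginv σ + kerProj σ) = psqrt ρ * ginv σ := by
      rw [Matrix.mul_add, hk, add_zero]
    have e2 : (ginv σ + kerProj σ) * psqrt ρ = ginv σ * psqrt ρ := by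
      rw [Matrix.add_mul, hk', add_zero]
    rw [← Matrix.mul_assoc, ← Matrix.mul_assoc, e1, Matrix.mul_assoc _ _ (psqrt ρ), e2]
    simp only [Matrix.mul_assoc]
  rw [DmaxLimit, Dmax_eq_log hρ hσ hρσ, Real.exp_neg, Real.exp_log hpos, ← hY'',
    Matrix.trace_mul_comm]
  rfl

end

/-! ### Passage to the limit in distribution. -/

section
open scoped Matrix.Norms.L2Operator

/-- The delta method for pairs of random operators. -/
theorem tendstoInDistribution_pair {d : ℕ} {Ω Ω' : Type*} [MeasurableSpace Ω] [MeasurableSpace Ω']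
    {P : Measure Ω} [IsProbabilityMeasure P] {P' : Measure Ω'} [IsProbabilityMeasure P']
    {f : Op d × Op d → ℝ} {f' : Op d × Op d →L[ℝ] ℝ} {S : Set (Op d × Op d)} {ρ σ : Op d}
    (hf : HasFDerivWithinAt f f' S (ρ, σ)) {r : ℕ → ℝ} (hr_pos : ∀ n, 0 < r n)
    (hr : Tendsto r atTop atTop) {ρn σn : ℕ → Ω → Op d}
    (hX : ∀ n, ∀ᵐ ω ∂P, (ρn n ω, σn n ω) ∈ S)
    (hfX : ∀ n, AEMeasurable (fun ω => f (ρn n ω, σn n ω)) P) {L₁ L₂ : Ω' → Op d}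
    (hL : TendstoInDistribution (fun n ω => (r n • (ρn n ω - ρ), r n • (σn n ω - σ))) atTop
      (fun ω => (L₁ ω, L₂ ω)) (fun _ => P) P') :
    TendstoInDistribution (fun n ω => r n * (f (ρn n ω, σn n ω) - f (ρ, σ))) atTop
      (fun ω => f' (L₁ ω, L₂ ω)) (fun _ => P) P' :=
  TendstoInDistribution.deltaMethod hf hr_pos hr hX hfX hL

end

end QuantumLimit

theorem mainTheorem7 {d : ℕ} {Ω Ω' : Type*} [MeasurableSpace Ω] [MeasurableSpace Ω']
    (P : Measure Ω) [IsProbabilityMeasure P] (P' : Measure Ω') [IsProbabilityMeasure P']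
    (r : ℕ → ℝ) (hr_pos : ∀ n, 0 < r n) (hr : Tendsto r atTop atTop)
    (ρ σ : QuantumLimit.Op d)
    (hρ : QuantumLimit.IsDensity ρ) (hσ : QuantumLimit.IsDensity σ)
    (ρn σn : ℕ → Ω → QuantumLimit.Op d)
    (hρn : ∀ n ω, QuantumLimit.IsDensity (ρn n ω))
    (hσn : ∀ n ω, QuantumLimit.IsDensity (σn n ω))
    (hρσ : QuantumLimit.Dominated ρ σ)
    (hρnσn : ∀ n, ∀ᵐ ω ∂P, QuantumLimit.Dominated (ρn n ω) (σn n ω))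
    (hσnσ : ∀ n, ∀ᵐ ω ∂P, QuantumLimit.Dominated (σn n ω) σ)
    (hρnρ : ∀ n, ∀ᵐ ω ∂P, QuantumLimit.Dominated (ρn n ω) ρ)
    (L₁ L₂ : Ω' → QuantumLimit.Op d)
    (hL : TendstoInDistribution
      (fun n ω => (r n • (ρn n ω - ρ), r n • (σn n ω - σ))) atTop
      (fun ω => (L₁ ω, L₂ ω)) (fun _ => P) P') :
    DifferentiableWithinAt ℝ QuantumLimit.psqrt (QuantumLimit.suppHermitian ρ) ρ ∧
    TendstoInDistribution
      (fun n ω => r n *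
        (QuantumLimit.fidelity (ρn n ω) (σn n ω) - QuantumLimit.fidelity ρ σ)) atTop
      (fun ω => QuantumLimit.fidelityLimit ρ σ (L₁ ω) (L₂ ω)) (fun _ => P) P' ∧
    (QuantumLimit.SimpleMaxEig
        (QuantumLimit.psqrt ρ * QuantumLimit.ginv σ * QuantumLimit.psqrt ρ) →
      TendstoInDistribution
        (fun n ω => r n *
          (QuantumLimit.Dmax (ρn n ω) (σn n ω) - QuantumLimit.Dmax ρ σ)) atTop
        (fun ω => QuantumLimit.DmaxLimit ρ σ (L₁ ω) (L₂ ω)) (fun _ => P) P') := by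
  obtain ⟨F', hF', hF⟩ := QuantumLimit.exists_hasFDerivWithinAt_fidelity hρ hσ hρσ
  have hX : ∀ n, ∀ᵐ ω ∂P, (ρn n ω, σn n ω) ∈ QuantumLimit.statePairs ρ σ := fun n => by
    filter_upwards [hρnσn n, hσnσ n, hρnρ n] with ω h1 h2 h3
    exact ⟨hρn n ω, hσn n ω, h1, h2, h3⟩
  -- Since `r n ≠ 0`, the pair is an affine image of the scaled deviation, whose measurability is
  -- part of `hL`.
  have hmeas : ∀ n, AEMeasurable (fun ω => (ρn n ω, σn n ω)) P := fun n => by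
    have h1 := ((hL.forall_aemeasurable n).const_smul (r n)⁻¹).add_const (ρ, σ)
    refine h1.congr (ae_of_all _ fun ω => ?_)
    simp [smul_smul, (hr_pos n).ne']
  refine ⟨(QuantumLimit.hasFDerivWithinAt_dsqrt hρ.1).differentiableWithinAt, ?_, fun hs => ?_⟩
  · simpa only [hF'] using QuantumLimit.tendstoInDistribution_pair hF hr_pos hr hX
      (fun n => QuantumLimit.aemeasurable_fidelity (hmeas n) fun ω => ⟨(hρn n ω).1, (hσn n ω).1⟩) hL
  · obtain ⟨D', hD', hD⟩ := QuantumLimit.exists_hasFDerivWithinAt_Dmax hρ hσ hρσ hs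
    simpa only [hD'] using QuantumLimit.tendstoInDistribution_pair hD hr_pos hr hX
      (fun n => QuantumLimit.aemeasurable_Dmax (hmeas n) (fun ω => ⟨hρn n ω, hσn n ω⟩)
        (hρnσn n)) hL
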